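/- Let $p>2$ be a prime, let $q=p^s>1$ be a power of $p$ that is a perfect square, and let $X$ be the non-singular projective model over $\mathbb{F}_{q^2}$ of the Artin–Schreier curve $y^{\sqrt q}+y=x^{(\sqrt q+1)/2}$. Let $P_\infty$ be its point at infinity (the unique pole of $x$), let $m\in\mathbb{Z}$ and $G=mP_\infty$, and let $D=P_1+\dots+P_d$ be a sum of $d$ distinct $\mathbb{F}_{q^2}$-rational points of $X$ different from $P_\infty$. Let $$C(D,G)=\{(f(P_1),\dots,f(P_d)) : f\in L(G)\}\subseteq\mathbb{F}_{q^2}^{\,d}$$ be the algebraic geometry code of $D$ and $G$, where $L(G)$ is the Riemann–Roch space of $G$ over $\mathbb{F}_{q^2}$. Let $g$ be the genus of $X$, i.e. the dimension of the space $H^0(X,\Omega^1)$ of holomorphic differentials of $X$ over $\overline{\mathbb{F}}_{q^2}$, and let $a(X)$ be the $a$-number of $X$, i.e. the dimension of the kernel of the Cartier operator on $H^0(X,\Omega^1)$. Then the minimum distance $\delta$ of $C(D,G)$, if this code is nonzero, satisfies $$\delta\ \ge\ d-m-2g+a(X).$$ More generally, the same bound holds for the minimum distance $\delta$ of every code $C\subseteq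 C(D,G)$ with at least two words, in particular for every nonzero subcode of $C(D,G)$ obtained by restricting $f$, for instance by means of the Cartier operator, to a subspace of $L(G)$. -/

import Mathlib

namespace CartierCode

open Polynomial

/-! ### Places, divisors, Riemann-Roch spaces of a function field `K` over `k` -/

/-- A place of `K` over `k`: a valuation ring `k ⊆ O ⊊ K` of `K`. When `K` is a function field in one
variable over `k`, these are the closed points of the smooth projective model. -/
structure Place (k K : Type*) [Field k] [Field K] [Algebra k K] where
  /-- the valuation ring of the place -/
  O : ValuationSubring K
  algebraMap_mem : ∀ c : k, algebraMap k K c ∈ O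
  ne_top : O ≠ ⊤

/-- `t` is a local parameter at `P`: it generates the maximal ideal of the valuation ring. -/
def Place.IsUniformizer {k K : Type*} [Field k] [Field K] [Algebra k K] (P : Place k K)
    (t : P.O) : Prop :=
  Ideal.span {t} = IsLocalRing.maximalIdeal P.O

/-- `P.HasValue f c`: the function `f` is regular at `P` with value `f(P) = c` in the constant field,
i.e. `f - c` lies in the maximal ideal of `P`. -/
def Place.HasValue {k K : Type*} [Field k] [Field K] [Algebra k K] (P : Place k K)
    (f : K) (c : k) : Prop :=
  P.O.valuation (f - algebraMap k K c) < 1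

/-- `P` is a rational point: its residue field is `k`. -/
def Place.IsRational {k K : Type*} [Field k] [Field K] [Algebra k K] (P : Place k K) : Prop :=
  ∀ f ∈ P.O, ∃ c : k, P.HasValue f c

/-- The Riemann-Roch space `L(G) = {f | ord_P f + G(P) ≥ 0 for all P}` of a divisor `G`; the condition
`ord_P f ≥ - G(P)` is expressed as `f * t ^ G(P) ∈ O_P` for `t` a local parameter at `P`. -/
def riemannRochSpace {k K : Type*} [Field k] [Field K] [Algebra k K] (G : Place k K →₀ ℤ) :
    Submodule k K where
  carrier := {f | ∀ (P : Place k K) (t : P.O), P.IsUniformizer t → f * (t : K) ^ (G P) ∈ P.O}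
  zero_mem' := fun P t _ => by simp
  add_mem' := fun {f g} hf hg P t ht => by
    rw [add_mul]
    exact P.O.add_mem _ _ (hf P t ht) (hg P t ht)
  smul_mem' := fun c f hf P t ht => by
    rw [Algebra.smul_def, mul_assoc]
    exact P.O.mul_mem _ _ (P.algebraMap_mem c) (hf P t ht)

/-! ### Algebraic geometry codes -/

/-- The algebraic geometry code `C(D, G)` for `D = P₁ + ⋯ + P_d`: the words
`(f(P₁), …, f(P_d))` with `f ∈ L(G)`. -/
def agCode {k K : Type*} [Field k] [Field K] [Algebra k K] {d : ℕ}
    (D : Fin d → Place k K) (G : Place k K →₀ ℤ) : Submodule k (Fin d → k) where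
  carrier := {w | ∃ f ∈ riemannRochSpace G, ∀ i, (D i).HasValue f (w i)}
  zero_mem' := ⟨0, Submodule.zero_mem _, fun i => by simp [Place.HasValue]⟩
  add_mem' := by
    rintro v w ⟨f, hf, hv⟩ ⟨g, hg, hw⟩
    refine ⟨f + g, Submodule.add_mem _ hf hg, fun i => ?_⟩
    have h := (D i).O.valuation.map_add_lt (hv i) (hw i)
    have e : f + g - algebraMap k K ((v + w) i)
        = (f - algebraMap k K (v i)) + (g - algebraMap k K (w i)) := by
      rw [Pi.add_apply, map_add]; ring
    rw [Place.HasValue, e]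
    exact h
  smul_mem' := by
    rintro c v ⟨f, hf, hv⟩
    refine ⟨c • f, Submodule.smul_mem _ c hf, fun i => ?_⟩
    have e : c • f - algebraMap k K ((c • v) i)
        = algebraMap k K c * (f - algebraMap k K (v i)) := by
      rw [Pi.smul_apply, smul_eq_mul, map_mul, Algebra.smul_def]; ring
    rw [Place.HasValue, e, map_mul]
    exact lt_of_le_of_lt
      (mul_le_of_le_one_left' (((D i).O.valuation_le_one_iff _).2 ((D i).algebraMap_mem c))) (hv i)

open Classical in
/-- The minimum (Hamming) distance between distinct words of a code with at least two words. -/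
noncomputable def minDist {k : Type*} {d : ℕ} (C : Set (Fin d → k)) : ℕ :=
  sInf {n | ∃ u ∈ C, ∃ v ∈ C, u ≠ v ∧ hammingDist u v = n}

/-! ### Holomorphic differentials, genus, Cartier operator, `a`-number -/

/-- `H⁰(X, Ω¹)`: the differentials `ω` of `K/k` that are regular at every place `P`, i.e. lie in the
`O_P`-submodule generated by the `da` with `a ∈ O_P` (which is `O_P dt`, `t` a local parameter). -/
def holomorphicDifferentials (k K : Type*) [Field k] [Field K] [Algebra k K] :
    Submodule k (Ω[K⁄k]) where
  carrier := {ω | ∀ P : Place k K,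
    ω ∈ Submodule.span P.O (Set.range fun a : P.O => KaehlerDifferential.D k K (a : K))}
  zero_mem' := fun P => Submodule.zero_mem _
  add_mem' := fun {v w} hv hw P => Submodule.add_mem _ (hv P) (hw P)
  smul_mem' := fun c v hv P => by
    have h := Submodule.smul_mem _ (⟨algebraMap k K c, P.algebraMap_mem c⟩ : P.O) (hv P)
    have e : (⟨algebraMap k K c, P.algebraMap_mem c⟩ : P.O) • v = c • v :=
      algebraMap_smul K c v
    rwa [e] at h

/-- The genus `dim_k H⁰(X, Ω¹)`. -/
noncomputable def genus (k K : Type*) [Field k] [Field K] [Algebra k K] : ℕ :=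
  Module.finrank k (holomorphicDifferentials k K)

/-- The graph of the Cartier operator, `p` being the characteristic of `K`: it sends
`ω = (f₀ ^ p + f₁ ^ p * t + ⋯ + f_{p-1} ^ p * t ^ (p-1)) dt` to `f_{p-1} dt`, for any separating
variable `t`. (If `t` is not separating, then `dt = 0` and the clause just says that `0` goes
to `0`.) -/
def IsCartierImage {k K : Type*} [Field k] [Field K] [Algebra k K] (ω η : Ω[K⁄k]) : Prop :=
  ∃ (t : K) (f : ℕ → K),
    ω = (∑ i ∈ Finset.range (ringChar K), f i ^ ringChar K * t ^ i) • KaehlerDifferential.D k K t ∧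
    η = f (ringChar K - 1) • KaehlerDifferential.D k K t

theorem isCartierImage_zero_iff {k K : Type*} [Field k] [Field K] [Algebra k K]
    (hp : (ringChar K).Prime) (ω : Ω[K⁄k]) :
    IsCartierImage ω 0 ↔ ∃ h : K, ω = KaehlerDifferential.D k K h := by
  constructor
  · rintro ⟨t, f, hω, h0⟩
    obtain ⟨n, hn⟩ : ∃ n, ringChar K = n + 1 := ⟨ringChar K - 1, by have := hp.pos; omega⟩
    have hK : ((ringChar K : ℕ) : K) = 0 := ringChar.Nat.cast_ringChar
    rw [hn] at hω h0 hK
    rw [Nat.add_sub_cancel] at h0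
    refine ⟨∑ i ∈ Finset.range n, f i ^ (n + 1) * (((i + 1 : ℕ) : K)⁻¹ * t ^ (i + 1)), ?_⟩
    have hpow : ∀ a : K, KaehlerDifferential.D k K (a ^ (n + 1)) = 0 := fun a => by
      rw [Derivation.leibniz_pow, ← Nat.cast_smul_eq_nsmul K, hK, zero_smul]
    have hnat : ∀ a : ℕ, KaehlerDifferential.D k K ((a : K)⁻¹) = 0 := fun a => by
      rw [Derivation.leibniz_inv, Derivation.map_natCast, smul_zero]
    have hlast : (f n ^ (n + 1) * t ^ n) • KaehlerDifferential.D k K t = 0 := by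
      have : f n ^ (n + 1) * t ^ n = (f n ^ n * t ^ n) * f n := by ring
      rw [this, mul_smul, ← h0, smul_zero]
    rw [hω, Finset.sum_range_succ, add_smul, hlast, add_zero, map_sum, Finset.sum_smul]
    refine Finset.sum_congr rfl fun i hi => ?_
    have hne : ((i + 1 : ℕ) : K) ≠ 0 := fun h => by
      have h1 := Nat.le_of_dvd (Nat.succ_pos i) ((ringChar.spec K (i + 1)).1 h)
      have h2 := Finset.mem_range.1 hi
      omega
    rw [Derivation.leibniz, hpow, smul_zero, add_zero, Derivation.leibniz, hnat, smul_zero,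
      add_zero, Derivation.leibniz_pow, Nat.add_sub_cancel, ← Nat.cast_smul_eq_nsmul K,
      smul_smul, smul_smul, smul_smul]
    congr 1
    field_simp
  · rintro ⟨h, rfl⟩
    refine ⟨h, fun i => if i = 0 then 1 else 0, ?_, ?_⟩
    · rw [Finset.sum_eq_single 0]
      · simp
      · intro b _ hb
        simp [hb, hp.ne_zero]
      · intro h0
        exact absurd (Finset.mem_range.2 hp.pos) h0
    · have : ringChar K - 1 ≠ 0 := by have := hp.two_le; omega
      simp [this]

/-- The kernel of the Cartier operator. -/
def cartierKernel (k K : Type*) [Field k] [Field K] [Algebra k K] : Submodule k (Ω[K⁄k]) where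
  carrier := {ω | IsCartierImage ω 0}
  zero_mem' := ⟨0, fun _ => 0, by simp, by simp⟩
  add_mem' := by
    intro v w hv hw
    rcases CharP.char_is_prime_or_zero K (ringChar K) with hp | hp
    · obtain ⟨a, rfl⟩ := (isCartierImage_zero_iff hp v).1 hv
      obtain ⟨b, rfl⟩ := (isCartierImage_zero_iff hp w).1 hw
      exact (isCartierImage_zero_iff hp _).2 ⟨a + b, (map_add _ a b).symm⟩
    · obtain ⟨t, f, hv, -⟩ := hv
      rw [hp] at hv
      rw [hv, Finset.range_zero, Finset.sum_empty, zero_smul, zero_add]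
      exact hw
  smul_mem' := by
    intro c v hv
    rcases CharP.char_is_prime_or_zero K (ringChar K) with hp | hp
    · obtain ⟨a, rfl⟩ := (isCartierImage_zero_iff hp v).1 hv
      exact (isCartierImage_zero_iff hp _).2 ⟨c • a, (Derivation.map_smul _ c a).symm⟩
    · have hv' := hv
      obtain ⟨t, f, hv, -⟩ := hv
      rw [hp] at hv
      have h0 : v = 0 := by
        rw [hv, Finset.range_zero, Finset.sum_empty, zero_smul]
      rw [h0] at hv' ⊢
      rw [smul_zero]
      exact hv'

/-- The `a`-number: the dimension of the kernel of the Cartier operator on `H⁰(X, Ω¹)`. -/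
noncomputable def aNumber (k K : Type*) [Field k] [Field K] [Algebra k K] : ℕ :=
  Module.finrank k (holomorphicDifferentials k K ⊓ cartierKernel k K : Submodule k (Ω[K⁄k]))

/-! ### The curve `y ^ r + y = x ^ ((r + 1) / 2)` -/

/-- `x ^ ((r + 1) / 2) - (y ^ r + y)` as a polynomial in `x` over `k[y]`. -/
noncomputable def curvePoly (k : Type*) [Field k] (r : ℕ) : (k[X])[X] :=
  X ^ ((r + 1) / 2) - C (X ^ r + X)

theorem curvePoly_prime (k : Type*) [Field k] (r : ℕ) (hr : 1 < r) : Prime (curvePoly k r) := by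
  have hm : (r + 1) / 2 ≠ 0 := by omega
  have hmonic : (curvePoly k r).Monic := monic_X_pow_sub_C _ hm
  have hdeg : (curvePoly k r).natDegree = (r + 1) / 2 := natDegree_X_pow_sub_C
  have hprime : (Ideal.span {(X : k[X])}).IsPrime :=
    (Ideal.span_singleton_prime X_ne_zero).2 prime_X
  have hE : (curvePoly k r).IsEisensteinAt (Ideal.span {(X : k[X])}) := by
    refine ⟨?_, ?_, ?_⟩
    · rw [hmonic.leadingCoeff]
      exact fun h => hprime.ne_top ((Ideal.eq_top_iff_one _).2 h)
    · intro n hn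
      rw [hdeg] at hn
      rw [Ideal.mem_span_singleton, curvePoly, coeff_sub, coeff_X_pow, if_neg hn.ne, zero_sub,
        coeff_C]
      split_ifs
      · exact (dvd_add (dvd_pow_self X (by omega)) dvd_rfl).neg_right
      · simp
    · rw [curvePoly, coeff_sub, coeff_X_pow, if_neg hm.symm, zero_sub, coeff_C_zero,
        Ideal.span_singleton_pow, Ideal.mem_span_singleton, dvd_neg]
      intro h
      have h1 := X_pow_dvd_iff.1 h 1 (by norm_num)
      rw [coeff_add, coeff_X_pow, if_neg hr.ne, coeff_X_one, zero_add] at h1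
      exact one_ne_zero h1
  exact (hE.irreducible hprime hmonic.isPrimitive (by rw [hdeg]; omega)).prime

/-- The affine coordinate ring `k[x, y] / (x ^ ((r + 1) / 2) - y ^ r - y)`. -/
abbrev CoordRing (k : Type*) [Field k] (r : ℕ) : Type _ := AdjoinRoot (curvePoly k r)

instance (k : Type*) [Field k] (r : ℕ) [hr : Fact (1 < r)] : IsDomain (CoordRing k r) :=
  AdjoinRoot.isDomain_of_prime (curvePoly_prime k r hr.out)

/-- The function field `k(x, y)`, `y ^ r + y = x ^ ((r + 1) / 2)`, of the curve over `k`. -/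
abbrev CurveField (k : Type*) [Field k] (r : ℕ) : Type _ := FractionRing (CoordRing k r)

/-- The coordinate function `x`. -/
noncomputable def xCoord (k : Type*) [Field k] (r : ℕ) : CurveField k r :=
  algebraMap (CoordRing k r) (CurveField k r) (AdjoinRoot.root (curvePoly k r))

/-- The coordinate function `y`. -/
noncomputable def yCoord (k : Type*) [Field k] (r : ℕ) : CurveField k r :=
  algebraMap (CoordRing k r) (CurveField k r) (AdjoinRoot.of (curvePoly k r) X)

theorem curve_equation (k : Type*) [Field k] (r : ℕ) :
    yCoord k r ^ r + yCoord k r = xCoord k r ^ ((r + 1) / 2) := by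
  have h : AdjoinRoot.mk (curvePoly k r) (X ^ ((r + 1) / 2) - C (X ^ r + X)) = 0 :=
    AdjoinRoot.mk_self
  rw [map_sub, map_pow, AdjoinRoot.mk_X, AdjoinRoot.mk_C, sub_eq_zero] at h
  have h' := congrArg (algebraMap (CoordRing k r) (CurveField k r)) h
  rw [map_pow, map_add, map_add, map_pow, map_pow] at h'
  exact h'.symm

/-- `P` is the point at infinity `P_∞`: the (unique) pole of `x`. -/
def IsPointAtInfinity {k : Type*} [Field k] {r : ℕ} [Fact (1 < r)]
    (P : Place k (CurveField k r)) : Prop :=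
  xCoord k r ∉ P.O

end CartierCode

/-!
The bound is a weakening of the Goppa bound `d - m ≤ δ`: since the `a`-number is the dimension of a
subspace of the space of holomorphic differentials, `a(X) ≤ g ≤ 2 g`. Two facts have to be
established, both by working in the affine coordinate ring `R = k[x, y]`, `n = (r + 1) / 2`, `r = 0`
in `k`, and its behaviour at the point at infinity.

*Local structure.* The derivative of `y ^ r + y` is `1`, so `R` is unramified over `k[x]`; its
localizations at maximal ideals are therefore discrete valuation rings and `R` is a Dedekind domain
(`isDedekindDomain_coordRing`). Places where `x` is regular are the maximal ideals of `R`
(`Place.exists_eq_ofPrime`). At a pole of `x`, the identity `2 n = r + 1` makes `x / y ^ 2` a local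
parameter, `y` has a pole of order `n` and `x` one of order `r`. As `n` and `r` are coprime, the
monomials `y ^ a * x ^ i` with `i < n` have distinct pole orders, so the valuation of a function in
`R` is read off from its expansion in the `k[y]`-basis `1, x, …, x ^ (n - 1)`
(`valuation_algebraMap`). In particular there is only one such place.

*Goppa bound.* A nonzero `f ∈ L(m P_∞)` lies in `R`, and by the Chinese remainder theorem the number
of its zeros is at most `dim R / (f)`, the degree of the norm `N(f) ∈ k[y]`. Expanding the
determinant that defines `N(f)` gives `v(N(f)) ≤ v(f) ^ n` at infinity, that is, `deg N(f) ≤ m`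
(`natDegree_norm_le`, `card_zeros_le`).

*Finiteness of the genus.* The inequality `a(X) ≤ g` between `finrank`s requires that the space of
holomorphic differentials be finite-dimensional. A holomorphic differential is `h dx` with `h`
regular at the maximal ideals of `R`, hence `h ∈ R`, and with a pole of bounded order at infinity,
which bounds the degrees of the coefficients of `h` (`holomorphicDifferentials_le_range`).
-/

namespace CartierCode

open Polynomial IsDedekindDomain

/-! ### The affine coordinate ring is a Dedekind domain -/

/-- At a prime `q` of `S` over `p = (a)`, unramifiedness says that `a` generates the maximal ideal
of `S_q`, which is therefore a discrete valuation ring. -/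
theorem isDedekindDomain_of_formallyUnramified (A S : Type*) [CommRing A] [IsDomain A]
    [IsPrincipalIdealRing A] [CommRing S] [IsDomain S] [IsNoetherianRing S] [Algebra A S]
    [Algebra.EssFiniteType A S] [Algebra.FormallyUnramified A S] : IsDedekindDomain S := by
  have : IsDedekindDomainDvr S := by
    refine { is_dvr_at_nonzero_prime := fun q hq hqp => ?_ }
    have hnf : ¬ IsField (Localization.AtPrime q) :=
      IsLocalization.AtPrime.not_isField S hq (Localization.AtPrime q)
    have : IsNoetherianRing (Localization.AtPrime q) :=
      IsLocalization.isNoetherianRing q.primeCompl _ inferInstance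
    refine ((IsDiscreteValuationRing.TFAE _ hnf).out 0 4).2 ?_
    let := Localization.AtPrime.algebraOfLiesOver (q.under A) q
    have hu : Algebra.IsUnramifiedAt A q := inferInstance
    obtain ⟨-, h⟩ := (Algebra.isUnramifiedAt_iff_map_eq A (q.under A) q).1 hu
    obtain ⟨a, ha⟩ := IsPrincipalIdealRing.principal (q.under A)
    rw [← h, ha, Ideal.submodule_span_eq, Ideal.map_span, Set.image_singleton]
    exact ⟨⟨_, rfl⟩⟩
  infer_instance

/-- The equation forces `dy = 0` in `Ω[S⁄k[x]]` because `d(y ^ r) = r y ^ (r - 1) dy = 0`; thus `S`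
is unramified over `k[x]`. -/
theorem isDedekindDomain_of_generators {k S : Type*} [Field k] [CommRing S] [IsDomain S]
    [Algebra k S] {x y : S} (hgen : Algebra.adjoin k {x, y} = ⊤) {r n : ℕ} (hr : (r : k) = 0)
    (hxy : y ^ r + y = x ^ n) : IsDedekindDomain S := by
  have hft : Algebra.FiniteType k S := ⟨Subalgebra.fg_def.2 ⟨{x, y}, Set.toFinite _, hgen⟩⟩
  have : IsNoetherianRing S := Algebra.FiniteType.isNoetherianRing k S
  let : Algebra k[X] S := (aeval x).toAlgebra
  have : IsScalarTower k k[X] S := IsScalarTower.of_algebraMap_eq fun c => by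
    change _ = aeval x (algebraMap k k[X] c)
    rw [AlgHom.commutes]
  have : Algebra.FiniteType k[X] S := Algebra.FiniteType.of_restrictScalars_finiteType k k[X] S
  have hrS : (r : S) = 0 := by
    rw [← map_natCast (algebraMap k S), hr, map_zero]
  have : Algebra.FormallyUnramified k[X] S := by
    refine ⟨?_⟩
    let δ : Derivation k S (Ω[S⁄k[X]]) := (KaehlerDifferential.D k[X] S).restrictScalars k
    have hδ : δ = 0 := by
      have hx : δ x = 0 := by
        have h := (KaehlerDifferential.D k[X] S).map_algebraMap X
        have e : algebraMap k[X] S X = x := aeval_X x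
        rwa [e] at h
      have hy : δ y = 0 := by
        have h := congrArg δ hxy
        rw [map_add, Derivation.leibniz_pow, Derivation.leibniz_pow, hx, smul_zero, smul_zero,
          ← Nat.cast_smul_eq_nsmul S, hrS, zero_smul, zero_add] at h
        exact h
      ext s
      refine Derivation.eqOn_adjoin (D1 := δ) (D2 := 0) (s := {x, y}) ?_ (hgen ▸ Algebra.mem_top)
      rintro z (rfl | rfl)
      · simpa using hx
      · simpa using hy
    rw [← Submodule.subsingleton_iff S, ← subsingleton_iff_bot_eq_top,
      ← KaehlerDifferential.span_range_derivation, eq_comm, Submodule.span_eq_bot]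
    rintro _ ⟨s, rfl⟩
    exact DFunLike.congr_fun hδ s
  exact isDedekindDomain_of_formallyUnramified k[X] S

theorem adjoin_root_of_X_eq_top (k : Type*) [Field k] (r : ℕ) :
    Algebra.adjoin k {AdjoinRoot.root (curvePoly k r), AdjoinRoot.of (curvePoly k r) X} = ⊤ := by
  rw [eq_top_iff]
  rintro f -
  induction f using AdjoinRoot.induction_on with
  | ih p =>
    induction p using Polynomial.induction_on' with
    | add p q hp hq => rw [map_add]; exact Subalgebra.add_mem _ hp hq
    | monomial i c =>
      rw [← C_mul_X_pow_eq_monomial, map_mul, map_pow, AdjoinRoot.mk_X, AdjoinRoot.mk_C]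
      refine Subalgebra.mul_mem _ ?_ (Subalgebra.pow_mem _ (Algebra.subset_adjoin (by simp)) _)
      have e : AdjoinRoot.of (curvePoly k r) c
          = aeval (AdjoinRoot.of (curvePoly k r) X) c := by
        have := (aeval_algHom_apply (Algebra.ofId k[X] (CoordRing k r) |>.restrictScalars k) X c)
        rw [aeval_X_left_apply] at this
        exact this.symm
      rw [e]
      exact Algebra.adjoin_mono (by simp) (aeval_mem_adjoin_singleton k _)

theorem coordRing_equation (k : Type*) [Field k] (r : ℕ) :
    AdjoinRoot.of (curvePoly k r) X ^ r + AdjoinRoot.of (curvePoly k r) X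
      = AdjoinRoot.root (curvePoly k r) ^ ((r + 1) / 2) := by
  have h : AdjoinRoot.mk (curvePoly k r) (X ^ ((r + 1) / 2) - C (X ^ r + X)) = 0 :=
    AdjoinRoot.mk_self
  rw [map_sub, map_pow, AdjoinRoot.mk_X, AdjoinRoot.mk_C, sub_eq_zero] at h
  rw [h, map_add, map_pow]

theorem isDedekindDomain_coordRing (k : Type*) [Field k] (r : ℕ) [Fact (1 < r)]
    (hr : (r : k) = 0) : IsDedekindDomain (CoordRing k r) :=
  isDedekindDomain_of_generators (adjoin_root_of_X_eq_top k r) hr (coordRing_equation k r)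

/-! ### The valuation at infinity -/

instance Place.isTrivialOn {k K : Type*} [Field k] [Field K] [Algebra k K] (P : Place k K) :
    P.O.valuation.IsTrivialOn k where
  eq_one c hc := by
    refine le_antisymm ((P.O.valuation_le_one_iff _).2 (P.algebraMap_mem c)) ?_
    have h := (P.O.valuation_le_one_iff _).2 (P.algebraMap_mem c⁻¹)
    rw [map_inv₀, map_inv₀] at h
    refine (inv_le_one₀ (zero_lt_iff.2 ?_)).1 h
    simpa using hc

section Basis

variable (k : Type*) [Field k] (r : ℕ)

theorem natDegree_curvePoly : (curvePoly k r).natDegree = (r + 1) / 2 := natDegree_X_pow_sub_C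

theorem algebraMap_of_eq_aeval (c : k[X]) :
    algebraMap (CoordRing k r) (CurveField k r) (AdjoinRoot.of (curvePoly k r) c)
      = aeval (yCoord k r) c := by
  have := aeval_algHom_apply ((IsScalarTower.toAlgHom k (CoordRing k r) (CurveField k r)).comp
    ((Algebra.ofId k[X] (CoordRing k r)).restrictScalars k)) X c
  rw [aeval_X_left_apply] at this
  exact this.symm

variable [hr : Fact (1 < r)]

theorem curvePoly_monic : (curvePoly k r).Monic :=
  monic_X_pow_sub_C _ (by have := hr.out; omega)

/-- The basis `1, x, …, x ^ ((r + 1) / 2 - 1)` of the affine coordinate ring over `k[y]`. -/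
noncomputable def xBasis : Module.Basis (Fin ((r + 1) / 2)) k[X] (CoordRing k r) :=
  (AdjoinRoot.powerBasis' (curvePoly_monic k r)).basis.reindex
    (finCongr (natDegree_curvePoly k r))

theorem xBasis_apply (i : Fin ((r + 1) / 2)) :
    xBasis k r i = AdjoinRoot.root (curvePoly k r) ^ (i : ℕ) := by
  rw [xBasis, Module.Basis.reindex_apply, PowerBasis.basis_eq_pow]
  rfl

theorem algebraMap_eq_sum (f : CoordRing k r) :
    algebraMap (CoordRing k r) (CurveField k r) f
      = ∑ i, aeval (yCoord k r) ((xBasis k r).repr f i) * xCoord k r ^ (i : ℕ) := by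
  conv_lhs => rw [← (xBasis k r).sum_repr f]
  rw [map_sum]
  refine Finset.sum_congr rfl fun i _ => ?_
  rw [xBasis_apply, Algebra.smul_def, map_mul, map_pow, ← algebraMap_of_eq_aeval]
  rfl

variable {k r}

/-- The order of the pole at infinity of a nonzero element of the affine coordinate ring,
computed from its expansion in the monomials `y ^ a * x ^ i` with `i < (r + 1) / 2`: there `y` has
a pole of order `(r + 1) / 2` and `x` one of order `r`. -/
noncomputable def poleOrder (f : CoordRing k r) : ℕ :=
  open Classical in Finset.univ.sup fun i => if (xBasis k r).repr f i = 0 then 0 else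
    (r + 1) / 2 * ((xBasis k r).repr f i).natDegree + r * i

theorem le_poleOrder {f : CoordRing k r} {i : Fin ((r + 1) / 2)}
    (hi : (xBasis k r).repr f i ≠ 0) :
    (r + 1) / 2 * ((xBasis k r).repr f i).natDegree + r * i ≤ poleOrder f := by
  classical
  have h := Finset.le_sup (f := fun i => if (xBasis k r).repr f i = 0 then 0 else
    (r + 1) / 2 * ((xBasis k r).repr f i).natDegree + r * (i : ℕ)) (Finset.mem_univ i)
  simpa only [poleOrder, if_neg hi] using h

end Basis

/-- Since `r = 2 n - 1` is prime to `n`, the exponents `n a + r i` with `i < n` determine `i`: the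
monomials `y ^ a * x ^ i` have distinct pole orders at infinity. -/
theorem eq_of_mul_add_mul_eq {r n a b i j : ℕ} (hn : 2 * n = r + 1) (hi : i < n) (hj : j < n)
    (h : n * a + r * i = n * b + r * j) : i = j := by
  -- Modulo `n` one has `r = 2 n - 1 ≡ -1`, hence `i ≡ j`.
  have h1 : (n : ℤ) ∣ i - j := ⟨a - b + 2 * i - 2 * j, by
    have hr : (r : ℤ) = 2 * n - 1 := by omega
    zify at h
    rw [hr] at h
    linear_combination -h⟩
  have h2 : (i : ℤ) - j = 0 := Int.eq_zero_of_abs_lt_dvd h1 (abs_lt.2 ⟨by omega, by omega⟩)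
  omega

section Infinity

variable {k : Type*} [Field k] {r : ℕ} [hr : Fact (1 < r)] {P : Place k (CurveField k r)}

/-- The valuation at `P` of `y ^ 2 / x`, the inverse of a local parameter at infinity. -/
noncomputable def poleUnit (P : Place k (CurveField k r)) : P.O.ValueGroup :=
  P.O.valuation (yCoord k r ^ 2 / xCoord k r)

theorem one_lt_valuation_xCoord (hP : IsPointAtInfinity P) : 1 < P.O.valuation (xCoord k r) := by
  rw [← not_le, P.O.valuation_le_one_iff]
  exact hP

theorem yCoord_mem_iff : yCoord k r ∈ P.O ↔ xCoord k r ∈ P.O := by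
  have hr := hr.out
  rw [← P.O.valuation_le_one_iff, ← P.O.valuation_le_one_iff]
  have h := congrArg P.O.valuation (curve_equation k r)
  rw [map_pow] at h
  constructor
  · intro hy
    refine (pow_le_one_iff (n := (r + 1) / 2) (by omega)).1 ?_
    rw [← h]
    exact (P.O.valuation.map_add_le (by rw [map_pow]; exact pow_le_one' hy _) hy)
  · contrapose!
    intro hy
    have h1 : P.O.valuation (yCoord k r) < P.O.valuation (yCoord k r ^ r) := by
      rw [map_pow]
      exact lt_self_pow₀ hy hr
    rw [P.O.valuation.map_add_eq_of_lt_left h1, map_pow] at h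
    refine (one_lt_pow_iff (n := (r + 1) / 2) (by omega)).1 ?_
    rw [← h]
    exact one_lt_pow' hy (by omega)

theorem one_lt_valuation_yCoord (hP : IsPointAtInfinity P) : 1 < P.O.valuation (yCoord k r) := by
  rw [← not_le, P.O.valuation_le_one_iff, yCoord_mem_iff]
  exact hP

/-- At a pole of `x` the term `y ^ r` dominates `y` in the equation of the curve. -/
theorem valuation_yCoord_pow (hP : IsPointAtInfinity P) :
    P.O.valuation (yCoord k r) ^ r = P.O.valuation (xCoord k r) ^ ((r + 1) / 2) := by
  have h := congrArg P.O.valuation (curve_equation k r)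
  have h1 : P.O.valuation (yCoord k r) < P.O.valuation (yCoord k r ^ r) := by
    rw [map_pow]
    exact lt_self_pow₀ (one_lt_valuation_yCoord hP) hr.out
  rwa [P.O.valuation.map_add_eq_of_lt_left h1, map_pow, map_pow] at h

theorem valuation_yCoord (hodd : Odd r) (hP : IsPointAtInfinity P) :
    P.O.valuation (yCoord k r) = poleUnit P ^ ((r + 1) / 2) := by
  have hn : 2 * ((r + 1) / 2) = r + 1 := by obtain ⟨a, rfl⟩ := hodd; omega
  have hy := (zero_lt_one.trans (one_lt_valuation_yCoord hP)).ne'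
  rw [poleUnit, map_div₀, map_pow, div_pow, ← pow_mul, ← valuation_yCoord_pow hP, hn, pow_succ,
    mul_div_cancel_left₀ _ (pow_ne_zero _ hy)]

theorem valuation_xCoord (hodd : Odd r) (hP : IsPointAtInfinity P) :
    P.O.valuation (xCoord k r) = poleUnit P ^ r := by
  have hn : 2 * ((r + 1) / 2) = r + 1 := by obtain ⟨a, rfl⟩ := hodd; omega
  have hy := (zero_lt_one.trans (one_lt_valuation_yCoord hP)).ne'
  have hx := (zero_lt_one.trans (one_lt_valuation_xCoord hP)).ne'
  have h : poleUnit P * P.O.valuation (xCoord k r) = poleUnit P * poleUnit P ^ r := by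
    rw [← pow_succ', ← hn, mul_comm 2, pow_mul, ← valuation_yCoord hodd hP, poleUnit, map_div₀,
      map_pow, div_mul_cancel₀ _ hx]
  refine mul_left_cancel₀ ?_ h
  rw [poleUnit, map_div₀, map_pow]
  exact div_ne_zero (pow_ne_zero _ hy) hx

theorem one_lt_poleUnit (hodd : Odd r) (hP : IsPointAtInfinity P) : 1 < poleUnit P := by
  have h := one_lt_valuation_xCoord hP
  rw [valuation_xCoord hodd hP] at h
  exact (one_lt_pow_iff (by have := hr.out; omega)).1 h

theorem valuation_monomial (hodd : Odd r) (hP : IsPointAtInfinity P) {c : k[X]} (hc : c ≠ 0)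
    (i : ℕ) : P.O.valuation (aeval (yCoord k r) c * xCoord k r ^ i)
      = poleUnit P ^ ((r + 1) / 2 * c.natDegree + r * i) := by
  rw [map_mul, map_pow, valuation_xCoord hodd hP,
    valuation_aeval_eq_valuation_X_pow_natDegree_of_one_lt_valuation_X _
      (one_lt_valuation_yCoord hP) hc, valuation_yCoord hodd hP, pow_add, pow_mul, pow_mul]

/-- The monomials in the expansion of `f` have distinct valuations at infinity, so the largest one
is the valuation of `f`. -/
theorem valuation_algebraMap (hodd : Odd r) (hP : IsPointAtInfinity P) {f : CoordRing k r}
    (hf : f ≠ 0) : P.O.valuation (algebraMap (CoordRing k r) (CurveField k r) f)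
      = poleUnit P ^ poleOrder f := by
  classical
  have hn : 2 * ((r + 1) / 2) = r + 1 := by obtain ⟨a, rfl⟩ := hodd; omega
  set S : Finset (Fin ((r + 1) / 2)) := Finset.univ.filter fun i => (xBasis k r).repr f i ≠ 0
  let e : Fin ((r + 1) / 2) → ℕ := fun i =>
    (r + 1) / 2 * ((xBasis k r).repr f i).natDegree + r * (i : ℕ)
  have hS : S.Nonempty := by
    by_contra hS
    rw [Finset.not_nonempty_iff_eq_empty, Finset.filter_eq_empty_iff] at hS
    exact hf ((xBasis k r).ext_elem fun i => by simpa using hS (Finset.mem_univ i))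
  obtain ⟨j, hjS, hj⟩ := S.exists_max_image e hS
  have hj0 : (xBasis k r).repr f j ≠ 0 := (Finset.mem_filter.1 hjS).2
  have hsup : poleOrder f = e j := by
    refine le_antisymm (Finset.sup_le fun i _ => ?_) (le_poleOrder hj0)
    split_ifs with hi
    · exact Nat.zero_le _
    · exact hj i (Finset.mem_filter.2 ⟨Finset.mem_univ i, hi⟩)
  have hσ := one_lt_poleUnit hodd hP
  rw [hsup, algebraMap_eq_sum, ← valuation_monomial hodd hP hj0]
  refine P.O.valuation.map_sum_eq_of_lt (Finset.mem_univ j) fun i hi => ?_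
  have hij : i ≠ j := by simpa using hi
  rw [valuation_monomial hodd hP hj0]
  by_cases hi0 : (xBasis k r).repr f i = 0
  · rw [hi0, map_zero, zero_mul, map_zero]
    exact pow_pos (zero_lt_one.trans hσ) _
  · rw [valuation_monomial hodd hP hi0]
    refine pow_lt_pow_right₀ hσ (lt_of_le_of_ne
      (hj i (Finset.mem_filter.2 ⟨Finset.mem_univ i, hi0⟩)) fun h => hij ?_)
    exact Fin.ext (eq_of_mul_add_mul_eq hn i.2 j.2 h)

/-- There is no cancellation at infinity among the terms of the expansion of `f` in powers of
`x`. -/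
theorem valuation_coeff_le (hodd : Odd r) (hP : IsPointAtInfinity P) (f : CoordRing k r)
    (i : Fin ((r + 1) / 2)) :
    P.O.valuation (aeval (yCoord k r) ((xBasis k r).repr f i) * xCoord k r ^ (i : ℕ))
      ≤ P.O.valuation (algebraMap (CoordRing k r) (CurveField k r) f) := by
  by_cases hi : (xBasis k r).repr f i = 0
  · rw [hi, map_zero, zero_mul, map_zero]
    exact zero_le
  · have hf : f ≠ 0 := by rintro rfl; simp at hi
    rw [valuation_monomial hodd hP hi, valuation_algebraMap hodd hP hf]
    exact pow_le_pow_right₀ (one_lt_poleUnit hodd hP).le (le_poleOrder hi)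

theorem place_ext {K : Type*} [Field K] [Algebra k K] {P Q : Place k K} (h : P.O = Q.O) :
    P = Q := by
  cases P; cases Q; congr

/-- There is at most one point at infinity: the valuation ring consists of the quotients `f / g`
with `poleOrder f ≤ poleOrder g`. -/
theorem IsPointAtInfinity.unique (hodd : Odd r) {Q : Place k (CurveField k r)}
    (hP : IsPointAtInfinity P) (hQ : IsPointAtInfinity Q) : P = Q := by
  refine place_ext (ValuationSubring.ext _ _ fun a => ?_)
  obtain ⟨f, g, hg, rfl⟩ := IsFractionRing.div_surjective (A := CoordRing k r) a
  have hg : g ≠ 0 := nonZeroDivisors.ne_zero hg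
  by_cases hf : f = 0
  · simp [hf]
  have key : ∀ P : Place k (CurveField k r), IsPointAtInfinity P →
      (algebraMap _ (CurveField k r) f / algebraMap _ (CurveField k r) g ∈ P.O ↔
        poleOrder f ≤ poleOrder g) := fun P hP => by
    have hσ := one_lt_poleUnit hodd hP
    rw [← P.O.valuation_le_one_iff, map_div₀, valuation_algebraMap hodd hP hf,
      valuation_algebraMap hodd hP hg, div_le_one₀ (pow_pos (zero_lt_one.trans hσ) _),
      pow_le_pow_iff_right₀ hσ]
  rw [key P hP, key Q hQ]

end Infinity

/-! ### Affine places and Riemann-Roch spaces -/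

section Dedekind

variable {k R K : Type*} [Field k] [CommRing R] [IsDedekindDomain R] [Field K] [Algebra k R]
  [Algebra R K] [IsFractionRing R K] [Algebra k K] [IsScalarTower k R K]

variable (k K) in
/-- The place of the fraction field `K` of a Dedekind domain `R ⊇ k` given by a maximal ideal `v`
of `R`: its valuation ring is the localization of `R` at `v`. -/
noncomputable def Place.ofPrime (v : HeightOneSpectrum R) : Place k K where
  O := HeightOneSpectrum.valuationSubringAtPrime K v
  algebraMap_mem c := by
    rw [IsScalarTower.algebraMap_apply k R K,
      IsScalarTower.algebraMap_apply R (HeightOneSpectrum.valuationSubringAtPrime K v) K]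
    exact SetLike.coe_mem _
  ne_top := by
    rw [HeightOneSpectrum.valuationSubringAtPrime_eq_valuationSubring, ne_eq,
      Valuation.valuationSubring_eq_top_iff, not_not]
    infer_instance

theorem Place.mem_ofPrime_iff {v : HeightOneSpectrum R} {a : K} :
    a ∈ (Place.ofPrime k K v).O ↔ v.valuation K a ≤ 1 := by
  change a ∈ HeightOneSpectrum.valuationSubringAtPrime K v ↔ _
  rw [HeightOneSpectrum.valuationSubringAtPrime_eq_valuationSubring]
  exact Iff.rfl

theorem Place.algebraMap_mem_ofPrime (v : HeightOneSpectrum R) (f : R) :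
    algebraMap R K f ∈ (Place.ofPrime k K v).O :=
  Place.mem_ofPrime_iff.2 (v.valuation_le_one f)

theorem Place.exists_isUniformizer_ofPrime (v : HeightOneSpectrum R) :
    ∃ t, (Place.ofPrime k K v).IsUniformizer t := by
  have : IsDiscreteValuationRing (HeightOneSpectrum.valuationSubringAtPrime K v) :=
    IsLocalization.AtPrime.isDiscreteValuationRing_of_dedekind_domain R v.ne_bot _
  obtain ⟨t, ht⟩ := IsPrincipalIdealRing.principal
    (IsLocalRing.maximalIdeal (HeightOneSpectrum.valuationSubringAtPrime K v))
  exact ⟨t, ht.symm⟩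

theorem Place.exists_mul_eq_of_mem_ofPrime {v : HeightOneSpectrum R} {a : K}
    (ha : a ∈ (Place.ofPrime k K v).O) :
    ∃ u w : R, w ∉ v.asIdeal ∧ a = algebraMap R K u / algebraMap R K w := by
  obtain ⟨u, w, h⟩ := v.exists_primeCompl_mul_eq_of_integer a (Place.mem_ofPrime_iff.1 ha)
  have hw : algebraMap R K w ≠ 0 := fun h0 => w.2 <| by
    rw [(FaithfulSMul.algebraMap_eq_zero_iff R K).1 h0]
    exact v.asIdeal.zero_mem
  exact ⟨u, w, w.2, by rw [← h, mul_div_cancel_right₀ _ hw]⟩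

/-- A place of the fraction field of a Dedekind domain `R` at which all elements of `R` are regular
comes from a maximal ideal of `R`. -/
theorem Place.exists_eq_ofPrime (P : Place k K) (hP : ∀ f : R, algebraMap R K f ∈ P.O) :
    ∃ v : HeightOneSpectrum R, P = Place.ofPrime k K v ∧
      ∀ f : R, f ∈ v.asIdeal ↔ P.O.valuation (algebraMap R K f) < 1 := by
  let φ : R →+* P.O := (algebraMap R K).codRestrict P.O.toSubring hP
  let I := (IsLocalRing.maximalIdeal P.O).comap φ
  have hI : ∀ f : R, f ∈ I ↔ P.O.valuation (algebraMap R K f) < 1 := fun f => by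
    rw [Ideal.mem_comap, P.O.valuation_lt_one_iff]
    rfl
  have hunit : ∀ w : R, w ∉ I → (algebraMap R K w)⁻¹ ∈ P.O := fun w hw => by
    rw [hI, not_lt] at hw
    rw [← P.O.valuation_le_one_iff, map_inv₀]
    exact inv_le_one_of_one_le₀ hw
  have hbot : I ≠ ⊥ := fun hbot => P.ne_top <| by
    rw [eq_top_iff]
    rintro a -
    obtain ⟨f, g, hg, rfl⟩ := IsFractionRing.div_surjective (A := R) a
    rw [div_eq_mul_inv]
    refine P.O.mul_mem _ _ (hP f) (hunit g fun h => nonZeroDivisors.ne_zero hg ?_)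
    rwa [hbot, Ideal.mem_bot] at h
  let v : HeightOneSpectrum R := ⟨I, inferInstance, hbot⟩
  refine ⟨v, place_ext (ValuationSubring.eq_of_le_of_ne_top
    (HeightOneSpectrum.valuationSubringAtPrime K v) ?_ P.ne_top).symm, hI⟩
  intro a ha
  obtain ⟨u, w, hw, rfl⟩ := Place.exists_mul_eq_of_mem_ofPrime (k := k) ha
  rw [div_eq_mul_inv]
  exact P.O.mul_mem _ _ (hP u) (hunit w hw)

end Dedekind

section Curve

variable {k : Type*} [Field k] {r : ℕ} [hr : Fact (1 < r)] {P : Place k (CurveField k r)}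

theorem algebraMap_mem_of_not_isPointAtInfinity (hP : ¬ IsPointAtInfinity P) (f : CoordRing k r) :
    algebraMap (CoordRing k r) (CurveField k r) f ∈ P.O := by
  rw [IsPointAtInfinity, not_not] at hP
  have hy := yCoord_mem_iff.2 hP
  rw [algebraMap_eq_sum]
  refine sum_mem fun i _ => mul_mem ?_ (pow_mem hP _)
  rw [aeval_eq_sum_range]
  refine sum_mem fun j _ => ?_
  rw [Algebra.smul_def]
  exact mul_mem (P.algebraMap_mem _) (pow_mem hy _)

theorem not_isPointAtInfinity_ofPrime [IsDedekindDomain (CoordRing k r)]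
    (v : HeightOneSpectrum (CoordRing k r)) :
    ¬ IsPointAtInfinity (Place.ofPrime k (CurveField k r) v) := fun h =>
  h (Place.algebraMap_mem_ofPrime v _)

/-- A function whose only pole is at infinity is regular at every maximal ideal of the affine
coordinate ring, so it belongs to that ring. -/
theorem mem_range_of_mem_riemannRochSpace [IsDedekindDomain (CoordRing k r)]
    (hP : IsPointAtInfinity P) {m : ℤ} {f : CurveField k r}
    (hf : f ∈ riemannRochSpace (Finsupp.single P m)) :
    f ∈ (algebraMap (CoordRing k r) (CurveField k r)).range := by
  refine HeightOneSpectrum.mem_integers_of_valuation_le_one _ _ fun v => ?_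
  obtain ⟨t, ht⟩ := Place.exists_isUniformizer_ofPrime (k := k) (K := CurveField k r) v
  have h := hf _ t ht
  have hne : Place.ofPrime k (CurveField k r) v ≠ P := fun h =>
    not_isPointAtInfinity_ofPrime v (h ▸ hP)
  rw [Finsupp.single_eq_of_ne hne, zpow_zero, mul_one] at h
  exact Place.mem_ofPrime_iff.1 h

/-- Every value of the valuation at infinity is a power of the value of `x / y ^ 2`. -/
theorem exists_valuation_eq_zpow (hodd : Odd r) (hP : IsPointAtInfinity P) {a : CurveField k r}
    (ha : a ≠ 0) : ∃ e : ℤ, P.O.valuation a = poleUnit P ^ e := by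
  obtain ⟨f, g, hg, rfl⟩ := IsFractionRing.div_surjective (A := CoordRing k r) a
  have hf : f ≠ 0 := by rintro rfl; simp at ha
  refine ⟨poleOrder f - poleOrder g, ?_⟩
  rw [map_div₀, valuation_algebraMap hodd hP hf,
    valuation_algebraMap hodd hP (nonZeroDivisors.ne_zero hg),
    zpow_sub₀ (zero_lt_one.trans (one_lt_poleUnit hodd hP)).ne', zpow_natCast, zpow_natCast]

/-- The function `x / y ^ 2` is a local parameter at infinity. -/
theorem exists_isUniformizer_infinity (hodd : Odd r) (hP : IsPointAtInfinity P) :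
    ∃ t, P.IsUniformizer t ∧ P.O.valuation (t : CurveField k r) = (poleUnit P)⁻¹ := by
  have hσ := one_lt_poleUnit hodd hP
  have hσ0 := (zero_lt_one.trans hσ).ne'
  set t : CurveField k r := (yCoord k r ^ 2 / xCoord k r)⁻¹
  have hvt : P.O.valuation t = (poleUnit P)⁻¹ := by rw [map_inv₀]; rfl
  have ht1 : P.O.valuation t < 1 := by rw [hvt]; exact inv_lt_one_of_one_lt₀ hσ
  have ht0 : t ≠ 0 := (P.O.valuation.ne_zero_iff).1 (by rw [hvt]; exact inv_ne_zero hσ0)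
  have htO : t ∈ P.O := (P.O.valuation_le_one_iff _).1 ht1.le
  refine ⟨⟨t, htO⟩, le_antisymm ?_ ?_, hvt⟩
  · rw [Ideal.span_singleton_le_iff_mem, P.O.valuation_lt_one_iff]
    exact ht1
  · intro a ha
    rw [P.O.valuation_lt_one_iff] at ha
    have hat : (a : CurveField k r) / t ∈ P.O := by
      rw [← P.O.valuation_le_one_iff]
      by_cases ha0 : (a : CurveField k r) = 0
      · simp [ha0]
      obtain ⟨e, he⟩ := exists_valuation_eq_zpow hodd hP ha0
      rw [he, zpow_lt_one_iff_right₀ hσ] at ha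
      rw [map_div₀, he, hvt, div_inv_eq_mul, ← zpow_add_one₀ hσ0, zpow_le_one_iff_right₀ hσ]
      omega
    rw [Ideal.mem_span_singleton]
    exact ⟨⟨_, hat⟩, Subtype.ext (by
      change (a : CurveField k r) = t * (a / t)
      rw [mul_div_cancel₀ _ ht0])⟩

theorem valuation_le_of_mem_riemannRochSpace (hodd : Odd r) (hP : IsPointAtInfinity P) {m : ℤ}
    {f : CurveField k r} (hf : f ∈ riemannRochSpace (Finsupp.single P m)) :
    P.O.valuation f ≤ poleUnit P ^ m := by
  obtain ⟨t, ht, hvt⟩ := exists_isUniformizer_infinity hodd hP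
  have hσ0 := zero_lt_one.trans (one_lt_poleUnit hodd hP)
  have h := hf P t ht
  rwa [Finsupp.single_eq_same, ← P.O.valuation_le_one_iff, map_mul, map_zpow₀, hvt, inv_zpow,
    ← div_eq_mul_inv, div_le_one₀ (zpow_pos hσ0 _)] at h

end Curve

/-! ### The norm, zeros of functions, and the Goppa bound -/

/-- By the Chinese remainder theorem `R ⧸ J` surjects onto the product of the nonzero spaces
`R ⧸ I i`. -/
theorem card_le_finrank_quotient {k R ι : Type*} [Field k] [CommRing R] [Algebra k R] [Fintype ι]
    {I : ι → Ideal R} (hI : Pairwise (Function.onFun IsCoprime I)) (htop : ∀ i, I i ≠ ⊤)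
    {J : Ideal R} (hJ : ∀ i, J ≤ I i) [FiniteDimensional k (R ⧸ J)] :
    Fintype.card ι ≤ Module.finrank k (R ⧸ J) := by
  let π : ∀ i, (R ⧸ J) →ₗ[k] R ⧸ I i := fun i => (Ideal.Quotient.factorₐ k (hJ i)).toLinearMap
  have hπ : ∀ i, Function.Surjective (π i) := fun i => Ideal.Quotient.factor_surjective (hJ i)
  have (i : ι) : FiniteDimensional k (R ⧸ I i) := Module.Finite.of_surjective (π i) (hπ i)
  have (i : ι) : Nontrivial (R ⧸ I i) := Ideal.Quotient.nontrivial_iff.2 (htop i)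
  have hsurj : Function.Surjective (LinearMap.pi π) := fun w => by
    obtain ⟨a, ha⟩ := Ideal.pi_quotient_surjective hI w
    exact ⟨Ideal.Quotient.mk J a, funext ha⟩
  calc Fintype.card ι = ∑ _i : ι, 1 := by simp
    _ ≤ ∑ i, Module.finrank k (R ⧸ I i) := Finset.sum_le_sum fun i _ => Module.finrank_pos
    _ = Module.finrank k (∀ i, R ⧸ I i) := (Module.finrank_pi_fintype k).symm
    _ ≤ Module.finrank k (R ⧸ J) := LinearMap.finrank_le_finrank_of_surjective hsurj

theorem finiteDimensional_quotient_of_basis {k S ι : Type*} [Field k] [CommRing S] [IsDomain S]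
    [Algebra k[X] S] [Algebra k S] [IsScalarTower k k[X] S] [Finite ι]
    (b : Module.Basis ι k[X] S) {I : Ideal S} (hI : I ≠ ⊥) : FiniteDimensional k (S ⧸ I) := by
  have := Fintype.ofFinite ι
  exact Module.Finite.equiv (I.quotientEquivDirectSum k b hI).symm

/-- In the product of the hypotheses over all `i` the factors `b (τ i)` and `b i` cancel. -/
theorem prod_le_pow_card_of_mul_le {Γ ι : Type*} [LinearOrderedCommGroupWithZero Γ] [Fintype ι]
    (τ : Equiv.Perm ι) {a b : ι → Γ} {c : Γ} (hb : ∀ i, 0 < b i)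
    (h : ∀ i, a i * b (τ i) ≤ c * b i) : ∏ i, a i ≤ c ^ Fintype.card ι := by
  have hprod := Finset.prod_le_prod' (s := Finset.univ) fun i _ => h i
  rw [Finset.prod_mul_distrib, Finset.prod_mul_distrib, Finset.prod_const, Finset.card_univ,
    Equiv.prod_comp τ b] at hprod
  exact le_of_mul_le_mul_right hprod
    (zero_lt_iff.2 (Finset.prod_ne_zero_iff.2 fun i _ => (hb i).ne'))

section Curve

variable {k : Type*} [Field k] {r : ℕ} [hr : Fact (1 < r)] {P : Place k (CurveField k r)}

/-- The matrix of multiplication by `f` in the basis `x ^ j` has entries `M i j` with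
`v(M i j) v(x) ^ i ≤ v(f) v(x) ^ j`, so every term of the Leibniz expansion of its determinant has
valuation at most `v(f) ^ n`. -/
theorem valuation_norm_le (hodd : Odd r) (hP : IsPointAtInfinity P) (f : CoordRing k r) :
    P.O.valuation (aeval (yCoord k r) (Algebra.norm k[X] f))
      ≤ P.O.valuation (algebraMap (CoordRing k r) (CurveField k r) f) ^ ((r + 1) / 2) := by
  classical
  have hx := one_lt_valuation_xCoord hP
  have hx0 := zero_lt_one.trans hx
  rw [Algebra.norm_eq_matrix_det (xBasis k r), Matrix.det_apply, map_sum]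
  refine P.O.valuation.map_sum_le fun τ _ => ?_
  have hsign : ∀ c : k[X], P.O.valuation (aeval (yCoord k r) (Equiv.Perm.sign τ • c))
      = P.O.valuation (aeval (yCoord k r) c) := fun c => by
    rcases Int.units_eq_one_or (Equiv.Perm.sign τ) with h | h
    · rw [h, one_smul]
    · rw [h, Units.neg_smul, one_smul, map_neg, Valuation.map_neg]
  rw [hsign, map_prod, map_prod]
  have hentry : ∀ i j, P.O.valuation (aeval (yCoord k r)
      (Algebra.leftMulMatrix (xBasis k r) f i j)) * P.O.valuation (xCoord k r) ^ (i : ℕ)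
      ≤ P.O.valuation (algebraMap (CoordRing k r) (CurveField k r) f)
        * P.O.valuation (xCoord k r) ^ (j : ℕ) := fun i j => by
    have h := valuation_coeff_le hodd hP (f * xBasis k r j) i
    have e : algebraMap (CoordRing k r) (CurveField k r) (f * xBasis k r j)
        = algebraMap (CoordRing k r) (CurveField k r) f * xCoord k r ^ (j : ℕ) := by
      rw [xBasis_apply, map_mul, map_pow]
      rfl
    rw [e, P.O.valuation.map_mul, P.O.valuation.map_mul, map_pow, map_pow] at h
    rwa [Algebra.leftMulMatrix_eq_repr_mul]
  have h := prod_le_pow_card_of_mul_le τ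
    (a := fun i => P.O.valuation (aeval (yCoord k r)
      (Algebra.leftMulMatrix (xBasis k r) f (τ i) i)))
    (fun i => pow_pos hx0 (i : ℕ)) fun i => hentry (τ i) i
  rwa [Fintype.card_fin] at h

theorem natDegree_norm_le (hodd : Odd r) (hP : IsPointAtInfinity P) {f : CoordRing k r}
    (hf : f ≠ 0) {m : ℤ}
    (hm : P.O.valuation (algebraMap (CoordRing k r) (CurveField k r) f) ≤ poleUnit P ^ m) :
    ((Algebra.norm k[X] f).natDegree : ℤ) ≤ m := by
  have hσ := one_lt_poleUnit hodd hP
  have hN : Algebra.norm k[X] f ≠ 0 := (Algebra.norm_ne_zero_iff_of_basis (xBasis k r)).2 hf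
  have hn : 0 < (r + 1) / 2 := by have := hr.out; omega
  have h := (valuation_norm_le hodd hP f).trans (pow_le_pow_left₀ zero_le hm _)
  rw [valuation_aeval_eq_valuation_X_pow_natDegree_of_one_lt_valuation_X _
      (one_lt_valuation_yCoord hP) hN, valuation_yCoord hodd hP, ← pow_mul, ← zpow_natCast,
    ← zpow_natCast, ← zpow_mul, zpow_le_zpow_iff_right₀ hσ, Nat.cast_mul, mul_comm] at h
  exact le_of_mul_le_mul_right h (by exact_mod_cast hn)

/-- A nonzero function in `L(m P)`, `P` the point at infinity, has at most `m` distinct zeros away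
from `P`. -/
theorem card_zeros_le [IsDedekindDomain (CoordRing k r)] (hodd : Odd r) (hP : IsPointAtInfinity P)
    {m : ℤ} {f : CurveField k r} (hf : f ∈ riemannRochSpace (Finsupp.single P m)) (hf0 : f ≠ 0)
    {ι : Type*} [Fintype ι] {D : ι → Place k (CurveField k r)} (hDinj : Function.Injective D)
    (hDinf : ∀ i, D i ≠ P) (hzero : ∀ i, (D i).HasValue f 0) : (Fintype.card ι : ℤ) ≤ m := by
  have hval := valuation_le_of_mem_riemannRochSpace hodd hP hf
  obtain ⟨f, rfl⟩ := mem_range_of_mem_riemannRochSpace hP hf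
  have hf0 : f ≠ 0 := by rintro rfl; simp at hf0
  have hDaff : ∀ i, ¬ IsPointAtInfinity (D i) := fun i h => hDinf i (h.unique hodd hP)
  choose v hv hmem using fun i => Place.exists_eq_ofPrime (D i)
    (algebraMap_mem_of_not_isPointAtInfinity (hDaff i))
  have hvinj : Function.Injective v := fun i j h => hDinj (by rw [hv i, hv j, h])
  have hcop : Pairwise (Function.onFun IsCoprime fun i => (v i).asIdeal) := fun i j hij =>
    Ideal.isCoprime_of_isMaximal fun h => hij (hvinj (HeightOneSpectrum.ext h))
  have hle : ∀ i, Ideal.span {f} ≤ (v i).asIdeal := fun i => by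
    rw [Ideal.span_singleton_le_iff_mem, hmem]
    have := hzero i
    rwa [Place.HasValue, map_zero, sub_zero] at this
  have := finiteDimensional_quotient_of_basis (xBasis k r) (Ideal.span_singleton_eq_bot.not.2 hf0)
  have hcard := card_le_finrank_quotient (k := k) hcop (fun i => (v i).isPrime.ne_top) hle
  rw [finrank_quotient_span_eq_natDegree_norm (xBasis k r) hf0] at hcard
  exact (Nat.cast_le.2 hcard).trans (natDegree_norm_le hodd hP hf0 hval)

/-- The Goppa bound `d - m ≤ δ` for codes contained in `C(D, m P)`. -/
theorem sub_le_minDist [IsDedekindDomain (CoordRing k r)] (hodd : Odd r)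
    (hP : IsPointAtInfinity P) {m : ℤ} {d : ℕ} {D : Fin d → Place k (CurveField k r)}
    (hDinj : Function.Injective D) (hDinf : ∀ i, D i ≠ P) {C : Set (Fin d → k)}
    (hC : C ⊆ agCode D (Finsupp.single P m)) (hCne : C.Nontrivial) :
    (d : ℤ) - m ≤ minDist C := by
  classical
  obtain ⟨u₀, hu₀, v₀, hv₀, huv₀⟩ := hCne
  obtain ⟨u, hu, v, hv, huv, hdist⟩ := Nat.sInf_mem
    (s := {n | ∃ u ∈ C, ∃ v ∈ C, u ≠ v ∧ hammingDist u v = n}) ⟨_, u₀, hu₀, v₀, hv₀, huv₀, rfl⟩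
  obtain ⟨f, hf, hval⟩ : u - v ∈ agCode D (Finsupp.single P m) :=
    Submodule.sub_mem _ (hC hu) (hC hv)
  have hf0 : f ≠ 0 := by
    rintro rfl
    obtain ⟨i, hi⟩ := Function.ne_iff.1 huv
    have h := hval i
    rw [Place.HasValue, zero_sub, Valuation.map_neg,
      Valuation.IsTrivialOn.eq_one _ (show (u - v) i ≠ 0 from sub_ne_zero.2 hi)] at h
    exact h.false
  have hcard := card_zeros_le hodd hP hf hf0 (ι := {i // u i = v i}) (D := fun i => D i)
    (hDinj.comp Subtype.val_injective) (fun i => hDinf i) fun i => by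
      have h := hval i
      rwa [Pi.sub_apply, i.2, sub_self] at h
  have hsum : Fintype.card {i // u i = v i} + hammingDist u v = d := by
    rw [Fintype.card_subtype, hammingDist, Finset.card_filter_add_card_filter_not,
      Finset.card_univ, Fintype.card_fin]
  have hmin : minDist C = hammingDist u v := by
    rw [hdist, minDist]
  omega

end Curve

/-! ### Holomorphic differentials -/

/-- If `da` is a multiple of `dx` by a function of bounded valuation for all `a` regular at `P`,
then so is every differential regular at `P`. -/
theorem exists_eq_smul_of_mem_span {k K : Type*} [Field k] [Field K] [Algebra k K] (P : Place k K)
    {x : K} {γ : P.O.ValueGroup} (h : ∀ a ∈ P.O, ∃ g : K, P.O.valuation g ≤ γ ∧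
      KaehlerDifferential.D k K a = g • KaehlerDifferential.D k K x) {ω : Ω[K⁄k]}
    (hω : ω ∈ Submodule.span P.O (Set.range fun a : P.O => KaehlerDifferential.D k K (a : K))) :
    ∃ g : K, P.O.valuation g ≤ γ ∧ ω = g • KaehlerDifferential.D k K x := by
  induction hω using Submodule.span_induction with
  | mem ω hω =>
    obtain ⟨a, rfl⟩ := hω
    exact h a a.2
  | zero => exact ⟨0, by simp, by simp⟩
  | add ω η _ _ hω hη =>
    obtain ⟨g, hg, rfl⟩ := hω
    obtain ⟨g', hg', rfl⟩ := hη
    exact ⟨g + g', P.O.valuation.map_add_le hg hg', (add_smul _ _ _).symm⟩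
  | smul c ω _ hω =>
    obtain ⟨g, hg, rfl⟩ := hω
    refine ⟨c * g, ?_, (smul_assoc c g _).symm⟩
    rw [map_mul]
    exact (mul_le_of_le_one_left' (P.O.valuation_le_one c)).trans hg

section Curve

variable {k : Type*} [Field k] {r : ℕ}

/-- As `d(y ^ r) = 0`, differentiating the equation of the curve gives `dy = n x ^ (n - 1) dx`. -/
theorem D_yCoord (hr0 : (r : k) = 0) :
    KaehlerDifferential.D k (CurveField k r) (yCoord k r)
      = (((r + 1) / 2 : ℕ) * xCoord k r ^ ((r + 1) / 2 - 1)) •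
        KaehlerDifferential.D k (CurveField k r) (xCoord k r) := by
  have hrK : (r : CurveField k r) = 0 := by
    rw [← map_natCast (algebraMap k (CurveField k r)), hr0, map_zero]
  have h := congrArg (KaehlerDifferential.D k (CurveField k r)) (curve_equation k r)
  rwa [map_add, Derivation.leibniz_pow, Derivation.leibniz_pow,
    ← Nat.cast_smul_eq_nsmul (CurveField k r), hrK, zero_smul, zero_add,
    ← Nat.cast_smul_eq_nsmul (CurveField k r), smul_smul] at h

variable [hr : Fact (1 < r)]

/-- The function `df / dx`, for `f` in the affine coordinate ring and `(r : k) = 0`. -/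
noncomputable def xDeriv (f : CoordRing k r) : CoordRing k r :=
  ∑ i, (AdjoinRoot.of (curvePoly k r) ((xBasis k r).repr f i)
      * ((i : ℕ) * AdjoinRoot.root (curvePoly k r) ^ ((i : ℕ) - 1))
    + AdjoinRoot.of (curvePoly k r) (derivative ((xBasis k r).repr f i))
      * AdjoinRoot.root (curvePoly k r) ^ (i : ℕ)
      * (((r + 1) / 2 : ℕ) * AdjoinRoot.root (curvePoly k r) ^ ((r + 1) / 2 - 1)))

theorem algebraMap_xDeriv (f : CoordRing k r) :
    algebraMap (CoordRing k r) (CurveField k r) (xDeriv f)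
      = ∑ i, (aeval (yCoord k r) ((xBasis k r).repr f i)
          * ((i : ℕ) * xCoord k r ^ ((i : ℕ) - 1))
        + aeval (yCoord k r) (derivative ((xBasis k r).repr f i)) * xCoord k r ^ (i : ℕ)
          * (((r + 1) / 2 : ℕ) * xCoord k r ^ ((r + 1) / 2 - 1))) := by
  rw [xDeriv, map_sum]
  refine Finset.sum_congr rfl fun i _ => ?_
  simp only [map_add, map_mul, map_pow, map_natCast, algebraMap_of_eq_aeval]
  rfl

theorem D_algebraMap (hr0 : (r : k) = 0) (f : CoordRing k r) :
    KaehlerDifferential.D k (CurveField k r) (algebraMap (CoordRing k r) (CurveField k r) f)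
      = algebraMap (CoordRing k r) (CurveField k r) (xDeriv f) •
        KaehlerDifferential.D k (CurveField k r) (xCoord k r) := by
  rw [algebraMap_xDeriv, algebraMap_eq_sum, map_sum, Finset.sum_smul]
  refine Finset.sum_congr rfl fun i _ => ?_
  rw [Derivation.leibniz, Derivation.leibniz_pow, Derivation.map_aeval,
    D_yCoord hr0, ← Nat.cast_smul_eq_nsmul (CurveField k r), smul_smul,
    smul_smul, smul_smul, smul_smul, ← add_smul]
  congr 1
  ring

theorem D_div (hr0 : (r : k) = 0) (f : CoordRing k r) {g : CoordRing k r} :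
    KaehlerDifferential.D k (CurveField k r)
        (algebraMap (CoordRing k r) (CurveField k r) f / algebraMap _ _ g)
      = (algebraMap (CoordRing k r) (CurveField k r) (g * xDeriv f - f * xDeriv g)
          / algebraMap _ _ g ^ 2) • KaehlerDifferential.D k (CurveField k r) (xCoord k r) := by
  rw [Derivation.leibniz_div, D_algebraMap hr0, D_algebraMap hr0, smul_smul, smul_smul, ← sub_smul,
    smul_smul, map_sub, map_mul, map_mul, div_eq_inv_mul, inv_pow]

variable {P : Place k (CurveField k r)}

theorem valuation_natCast_le_one (P : Place k (CurveField k r)) (i : ℕ) :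
    P.O.valuation (i : CurveField k r) ≤ 1 :=
  (P.O.valuation_le_one_iff _).2 (natCast_mem P.O i)

theorem valuation_derivative_le (hP : IsPointAtInfinity P) (c : k[X]) :
    P.O.valuation (aeval (yCoord k r) (derivative c)) ≤ P.O.valuation (aeval (yCoord k r) c) := by
  have hy := one_lt_valuation_yCoord hP
  by_cases hc' : derivative c = 0
  · simp [hc']
  have hc : c ≠ 0 := by rintro rfl; simp at hc'
  rw [valuation_aeval_eq_valuation_X_pow_natDegree_of_one_lt_valuation_X _ hy hc,
    valuation_aeval_eq_valuation_X_pow_natDegree_of_one_lt_valuation_X _ hy hc']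
  exact pow_le_pow_right₀ hy.le ((natDegree_derivative_le c).trans (Nat.sub_le _ _))

/-- Differentiation with respect to `x` increases the pole order at infinity by at most that of
`dy / dx = n x ^ (n - 1)`. -/
theorem valuation_xDeriv_le (hodd : Odd r) (hP : IsPointAtInfinity P) (f : CoordRing k r) :
    P.O.valuation (algebraMap (CoordRing k r) (CurveField k r) (xDeriv f))
      ≤ P.O.valuation (xCoord k r) ^ ((r + 1) / 2 - 1)
        * P.O.valuation (algebraMap (CoordRing k r) (CurveField k r) f) := by
  have hx := one_lt_valuation_xCoord hP
  rw [algebraMap_xDeriv]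
  refine P.O.valuation.map_sum_le fun i _ => P.O.valuation.map_add_le ?_ ?_
  · refine le_trans ?_ ((valuation_coeff_le hodd hP f i).trans
      (le_mul_of_one_le_left' (one_le_pow₀ hx.le)))
    rw [map_mul, map_mul, map_mul, map_pow, map_pow]
    gcongr
    exact (mul_le_of_le_one_left' (valuation_natCast_le_one P _)).trans
      (pow_le_pow_right₀ hx.le (Nat.sub_le _ _))
  · rw [map_mul, mul_comm, map_mul, map_pow]
    gcongr
    · exact mul_le_of_le_one_left' (valuation_natCast_le_one P _)
    · refine le_trans ?_ (valuation_coeff_le hodd hP f i)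
      rw [map_mul, map_mul]
      gcongr
      exact valuation_derivative_le hP _

/-- The differentials regular at infinity are multiples `h dx` with `v(h)` bounded. -/
theorem exists_D_eq_smul_infinity (hr0 : (r : k) = 0) (hodd : Odd r) (hP : IsPointAtInfinity P) :
    ∀ a ∈ P.O, ∃ h : CurveField k r,
      P.O.valuation h ≤ P.O.valuation (xCoord k r) ^ ((r + 1) / 2 - 1) ∧
      KaehlerDifferential.D k (CurveField k r) a
        = h • KaehlerDifferential.D k (CurveField k r) (xCoord k r) := by
  intro a ha
  obtain ⟨f, g, hg, rfl⟩ := IsFractionRing.div_surjective (A := CoordRing k r) a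
  refine ⟨_, ?_, D_div hr0 f⟩
  have hg0 : 0 < P.O.valuation (algebraMap (CoordRing k r) (CurveField k r) g) := by
    rw [zero_lt_iff, Valuation.ne_zero_iff, ne_eq, FaithfulSMul.algebraMap_eq_zero_iff]
    exact nonZeroDivisors.ne_zero hg
  rw [← P.O.valuation_le_one_iff, map_div₀, div_le_one₀ hg0] at ha
  rw [map_div₀, map_pow, div_le_iff₀ (pow_pos hg0 2), map_sub, map_mul, map_mul, sq, ← mul_assoc]
  have hf' := valuation_xDeriv_le hodd hP f
  have hg' := valuation_xDeriv_le hodd hP g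
  refine P.O.valuation.map_sub_le ?_ ?_
  · rw [map_mul, mul_comm]
    gcongr
    exact hf'.trans (by gcongr)
  · rw [map_mul, mul_comm]
    gcongr

/-- At an affine place `dx` generates the regular differentials. -/
theorem exists_D_eq_smul_ofPrime [IsDedekindDomain (CoordRing k r)] (hr0 : (r : k) = 0)
    (v : HeightOneSpectrum (CoordRing k r)) :
    ∀ a ∈ (Place.ofPrime k (CurveField k r) v).O, ∃ h : CurveField k r,
      (Place.ofPrime k (CurveField k r) v).O.valuation h ≤ 1 ∧
      KaehlerDifferential.D k (CurveField k r) a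
        = h • KaehlerDifferential.D k (CurveField k r) (xCoord k r) := by
  intro a ha
  obtain ⟨u, w, hw, rfl⟩ := Place.exists_mul_eq_of_mem_ofPrime ha
  refine ⟨_, ?_, D_div hr0 u⟩
  rw [ValuationSubring.valuation_le_one_iff, Place.mem_ofPrime_iff, map_div₀, map_pow,
    (v.valuation_eq_one_iff_notMem (K := CurveField k r)).2 hw, one_pow, div_one]
  exact v.valuation_le_one _

variable (k r) in
/-- The function `y` is transcendental over `k`, hence not integral over it, so some valuation ring
over `k` omits it. -/
theorem exists_isPointAtInfinity : ∃ P : Place k (CurveField k r), IsPointAtInfinity P := by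
  have hn : 0 < (r + 1) / 2 := by have := hr.out; omega
  have : Nonempty (Fin ((r + 1) / 2)) := ⟨⟨0, hn⟩⟩
  have hy : yCoord k r ∉ (integralClosure k (CurveField k r)).toSubring := by
    rintro ⟨c, hc, h⟩
    rw [← aeval_def, ← algebraMap_of_eq_aeval, FaithfulSMul.algebraMap_eq_zero_iff] at h
    exact hc.ne_zero ((xBasis k r).algebraMap_injective (h.trans (map_zero _).symm))
  have : IsIntegrallyClosedIn (integralClosure k (CurveField k r)).toSubring (CurveField k r) :=
    inferInstanceAs (IsIntegrallyClosedIn (integralClosure k (CurveField k r)) (CurveField k r))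
  obtain ⟨V, hV, hyV⟩ := Subring.exists_le_valuationSubring_of_isIntegrallyClosedIn hy
  let P : Place k (CurveField k r) :=
    ⟨V, fun c => hV (Subalgebra.algebraMap_mem (integralClosure k (CurveField k r)) c),
      fun h => hyV (h ▸ ValuationSubring.mem_top _)⟩
  exact ⟨P, fun h => hyV ((yCoord_mem_iff (P := P)).2 h)⟩

/-- The differentials `(∑ i, c i (y) * x ^ i) dx` with polynomials `c i` of degree less than `M`. -/
noncomputable def polynomialDifferentials (k : Type*) [Field k] (r M : ℕ) :
    (Fin ((r + 1) / 2) → degreeLT k M) →ₗ[k] Ω[CurveField k r⁄k] :=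
  ((LinearMap.toSpanSingleton (CurveField k r) _
      (KaehlerDifferential.D k (CurveField k r) (xCoord k r))).restrictScalars k).comp
    (∑ i : Fin ((r + 1) / 2), (LinearMap.mulRight k (xCoord k r ^ (i : ℕ))).comp
      ((aeval (yCoord k r)).toLinearMap.comp ((degreeLT k M).subtype.comp (LinearMap.proj i))))

/-- A holomorphic differential is `h dx` with `h` in the affine coordinate ring, and the bound at
infinity limits the degree in `y` of each coefficient of `h`. -/
theorem holomorphicDifferentials_le_range (hr0 : (r : k) = 0) (hodd : Odd r) :
    holomorphicDifferentials k (CurveField k r)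
      ≤ (polynomialDifferentials k r (r * ((r + 1) / 2 - 1) + 1)).range := by
  intro ω hω
  have := isDedekindDomain_coordRing k r hr0
  obtain ⟨P, hP⟩ := exists_isPointAtInfinity k r
  have hσ := one_lt_poleUnit hodd hP
  obtain ⟨h, hh, rfl⟩ := exists_eq_smul_of_mem_span P
    (exists_D_eq_smul_infinity hr0 hodd hP) (hω P)
  -- If `dx = 0` every differential vanishes; otherwise `h` is determined by `h dx`.
  by_cases hx : KaehlerDifferential.D k (CurveField k r) (xCoord k r) = 0
  · rw [hx, smul_zero]
    exact Submodule.zero_mem _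
  obtain ⟨f, rfl⟩ : h ∈ (algebraMap (CoordRing k r) (CurveField k r)).range := by
    refine HeightOneSpectrum.mem_integers_of_valuation_le_one _ _ fun v => ?_
    obtain ⟨h', hh', he⟩ := exists_eq_smul_of_mem_span _ (exists_D_eq_smul_ofPrime hr0 v) (hω _)
    rw [smul_left_injective _ hx he]
    exact Place.mem_ofPrime_iff.1 ((ValuationSubring.valuation_le_one_iff _ _).1 hh')
  refine ⟨fun i => ⟨(xBasis k r).repr f i, ?_⟩, ?_⟩
  · by_cases hi : (xBasis k r).repr f i = 0
    · rw [hi]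
      exact Submodule.zero_mem _
    have hle := (valuation_coeff_le hodd hP f i).trans hh
    rw [valuation_monomial hodd hP hi, valuation_xCoord hodd hP, ← pow_mul,
      pow_le_pow_iff_right₀ hσ] at hle
    rw [mem_degreeLT, degree_eq_natDegree hi, Nat.cast_lt, Nat.lt_succ_iff]
    have hn : 0 < (r + 1) / 2 := by have := hr.out; omega
    exact (Nat.le_mul_of_pos_left _ hn).trans ((Nat.le_add_right _ _).trans hle)
  · refine Eq.trans ?_ (congrArg
      (fun a : CurveField k r => a • KaehlerDifferential.D k (CurveField k r) (xCoord k r))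
      (algebraMap_eq_sum k r f).symm)
    simp [polynomialDifferentials, Finset.sum_smul]

theorem finiteDimensional_holomorphicDifferentials (hr0 : (r : k) = 0) (hodd : Odd r) :
    FiniteDimensional k (holomorphicDifferentials k (CurveField k r)) := by
  have (M : ℕ) : FiniteDimensional k (degreeLT k M) :=
    Module.Finite.equiv (degreeLTEquiv k M).symm
  exact Submodule.finiteDimensional_of_le (holomorphicDifferentials_le_range hr0 hodd)

theorem aNumber_le_genus (hr0 : (r : k) = 0) (hodd : Odd r) :
    aNumber k (CurveField k r) ≤ genus k (CurveField k r) := by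
  have := finiteDimensional_holomorphicDifferentials hr0 hodd
  exact Submodule.finrank_mono inf_le_left

end Curve

end CartierCode

theorem mainTheorem3 (p s r : ℕ) (hp : p.Prime) (hp2 : 2 < p)
    (hr : r ^ 2 = p ^ s) [Fact (1 < r)]
    (F : Type*) [Field F] [Finite F] (hF : Nat.card F = (p ^ s) ^ 2)
    (Pinf : CartierCode.Place F (CartierCode.CurveField F r))
    (hPinf : CartierCode.IsPointAtInfinity Pinf)
    (m : ℤ) (d : ℕ) (D : Fin d → CartierCode.Place F (CartierCode.CurveField F r))
    (hDinj : Function.Injective D) (hDrat : ∀ i, (D i).IsRational) (hDinf : ∀ i, D i ≠ Pinf)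
    (C : Set (Fin d → F))
    (hC : C ⊆ CartierCode.agCode D (Finsupp.single Pinf m)) (hCne : C.Nontrivial) :
    (d : ℤ) - m
        - 2 * (CartierCode.genus (AlgebraicClosure F)
            (CartierCode.CurveField (AlgebraicClosure F) r) : ℤ)
        + (CartierCode.aNumber (AlgebraicClosure F)
            (CartierCode.CurveField (AlgebraicClosure F) r) : ℤ)
      ≤ (CartierCode.minDist C : ℤ) := by
  have hodd : Odd r := by
    refine (Nat.odd_pow_iff two_ne_zero).1 ?_
    rw [hr]
    exact (hp.odd_of_ne_two (by omega)).pow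
  have hrF : (r : F) = 0 := by
    have := Fintype.ofFinite F
    have h := FiniteField.cast_card_eq_zero F
    rw [← Nat.card_eq_fintype_card, hF, ← hr] at h
    simpa using h
  have hrF' : (r : AlgebraicClosure F) = 0 := by
    rw [← map_natCast (algebraMap F (AlgebraicClosure F)), hrF, map_zero]
  have := CartierCode.isDedekindDomain_coordRing F r hrF
  have hgoppa := CartierCode.sub_le_minDist hodd hPinf hDinj hDinf hC hCne
  have ha := CartierCode.aNumber_le_genus hrF' hodd
  omega
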